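/- Let $p$ be a prime and let $\mathcal{D}$ be a Dedekind domain, not a field, finitely generated as a ring over $\mathbb{F}_p$. Let $\mathbb{F}_q$ be the integral closure of $\mathbb{F}_p$ in $\mathcal{D}$, let $C$ be the complete non-singular curve over $\mathbb{F}_q$ containing $\operatorname{Spec}\mathcal{D}$ as an open subscheme, and let $n$ be the cardinality of the (finite, non-empty) complement $C\setminus\operatorname{Spec}\mathcal{D}$, whose elements are called the places at infinity of $\mathcal{D}$ (equivalently, they are the discrete valuation rings of $\operatorname{Frac}\mathcal{D}$ not containing $\mathcal{D}$). For a place $v$ at infinity with normalized valuation $v\colon(\operatorname{Frac}\mathcal{D})^*\twoheadrightarrow\mathbb{Z}$ and residue field $\mathbb{F}(v)$, put $\|\alpha\|_v=(1/\#\mathbb{F}(v))^{v(\alpha)}$ for $0\ne\alpha\in\mathcal{D}$ and $\|0\|_v=0$, and define the canonical norm $\|\alpha\|_{\mathcal{D}}=\max_v\|\alpha\|_v$, the maximum being over the places $v$ at infinity. Then there exists an element $t\in\mathcal{D}$ such that (1) $\mathcal{D}$ is finite over its subring $\mathcal{O}=\mathbb{F}_q[t]$, and (2) the value $\|t\|_v$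 is independent of the place $v$ at infinity. Furthermore, for every $t\in\mathcal{D}$ satisfying (1) and (2), the common value in (2) is $q^d$ for a non-negative integer $d$, the rank of $\mathcal{D}$ over $\mathcal{O}$ equals $nd$, and, writing $\|\cdot\|_{\mathcal{O}}$ for the canonical norm of the Dedekind domain $\mathcal{O}$ (defined in the same way from the places at infinity of $\mathcal{O}$), one has $\|f\|_{\mathcal{O}}^d=\|f\|_v$ for all $f\in\mathcal{O}$ and all places $v$ at infinity of $\mathcal{D}$, and in particular $\|f\|_{\mathcal{O}}^d=\|f\|_{\mathcal{D}}$ for all $f\in\mathcal{O}$. -/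

import Mathlib

/-- A discrete valuation ring of `Frac D` which does not contain `D`. When `D` is a Dedekind domain,
not a field, finitely generated over a finite field, the closed points of the complete non-singular
curve with function field `Frac D` are the discrete valuation rings of `Frac D` (they contain the
constant field automatically); the points of `Spec D` are those containing `D`, so the places below
are the points of the complement of `Spec D`. -/
structure PlaceAtInfinity (D : Type*) [CommRing D] [IsDomain D] where
  /-- The valuation ring of the place. -/
  ring : ValuationSubring (FractionRing D)
  isDVR : IsDiscreteValuationRing ring
  not_contains : ¬ (algebraMap D (FractionRing D)).range ≤ ring.toSubring

namespace PlaceAtInfinity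

variable {D : Type*} [CommRing D] [IsDomain D]

instance (v : PlaceAtInfinity D) : IsDiscreteValuationRing v.ring := v.isDVR

/-- The normalized discrete valuation `v : Frac(D)ˣ → ℤ` of a place
(the value at `0` is a junk value). -/
noncomputable def ord (v : PlaceAtInfinity D) (x : FractionRing D) : ℤ :=
  -WithZero.log ((IsDiscreteValuationRing.maximalIdeal v.ring).valuation (FractionRing D) x)

/-- The residue field of a place. -/
abbrev residueField (v : PlaceAtInfinity D) : Type _ := IsLocalRing.ResidueField v.ring

open Classical in
/-- The norm `‖a‖_v = (1 / #F(v)) ^ v(a)` on `D`, with `‖0‖_v = 0`. -/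
noncomputable def norm (v : PlaceAtInfinity D) (a : D) : ℝ :=
  if a = 0 then 0
  else (1 / (Nat.card v.residueField : ℝ)) ^ v.ord (algebraMap D (FractionRing D) a)

end PlaceAtInfinity

/-- The canonical norm `‖a‖ = max_v ‖a‖_v`, over all places `v` at infinity. -/
noncomputable def canonicalNorm {D : Type*} [CommRing D] [IsDomain D] (a : D) : ℝ :=
  ⨆ v : PlaceAtInfinity D, v.norm a

/-- The constant field `F_q`: the integral closure of `F_p` in `D`. -/
abbrev constantField (p : ℕ) [Fact p.Prime] (D : Type*) [CommRing D] [Algebra (ZMod p) D] :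
    Subalgebra (ZMod p) D :=
  integralClosure (ZMod p) D

/-- The subring `F_q[t]` of `D`. -/
def polySubring (p : ℕ) [Fact p.Prime] {D : Type*} [CommRing D] [Algebra (ZMod p) D] (t : D) :
    Subring D :=
  (Algebra.adjoin (constantField p D) {t}).toSubring

/-- `D` is finite over `F_q[t]`, and `‖t‖_v` is independent of the place `v` at infinity. -/
def IsAdmissible (p : ℕ) [Fact p.Prime] {D : Type*} [CommRing D] [IsDomain D]
    [Algebra (ZMod p) D] (t : D) : Prop :=
  Module.Finite (polySubring p t) D ∧ ∀ v w : PlaceAtInfinity D, v.norm t = w.norm t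

/-!
Fix a finite field `F` and a domain `D` which is finite over a polynomial ring `F[X]`; write `t`
for the image of `X`, `K` for `Frac D`, `q` for the cardinality of `F` and `r` for the rank of
`D`. Since `D` is integral over `F[X]`, a valuation ring of `K` fails to contain `D` exactly when
it fails to contain `t`. The heart of the matter is the product formula `∏_v ‖t‖_v = q ^ r` over
the places at infinity (`PlaceAtInfinity.prod_absVal_X`), that is, `∑ e_v f_v = r`. The extension
`K / F(t)` may be inseparable, so finiteness of integral closures over `F[1/t]` is not at hand;
the formula is obtained by counting instead.

* If a subring `R` of `K` contains `F` and `1/t`, then `R / (1/t)` has dimension at most `r` over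
  `F` (`rank_quotient_span_le`): a relation with coefficients in `F[t]` between elements of `R`
  becomes, after multiplication by the power of `1/t` matching the largest degree, a relation over
  `F` modulo `1/t`. Applied to a valuation ring not containing `t`, this shows that it is discrete
  with finite residue field.
* By weak approximation, for an intersection `R` of finitely many valuation rings of places the
  cardinality of `R / (1/t)` is `∏ ‖t‖_v` (`PlaceAtInfinity.card_quotient_commonRing`). As this is
  at most `q ^ r` and every factor is at least `2`, the places are finite in number, and
  `∏_v ‖t‖_v ≤ q ^ r` for the product over all of them.
* For the opposite inequality let `N = ∏_v ‖t‖_v` and let `L m` be the group of the `a ∈ D` with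
  `‖a‖_v ≤ ‖t‖_v ^ (m - 1)` for all `v`. Each step `L (m + 1) / L m` embeds into `R / (1/t)`, and
  `L 0 = 0`, since an element of `L 0` is integral over `F` while having absolute value less than
  `1`; so `L m` has at most `N ^ m` elements. But the combinations of a basis of `D` with
  coefficients of degree less than `m` lie in `L (m + c)`, so that `q ^ (r m) ≤ N ^ (m + c)` for
  all `m`, whence `q ^ r ≤ N`.

For the existence of an admissible element, Noether normalization makes `D` finite over a
polynomial ring over `F_p`. Division with remainder shows that every element of `K` differs from
an element of `D` by an amount bounded at all places at infinity, and with weak approximation this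
gives `t ∈ D` whose absolute values at all places have a common value larger than `1`. An element
of `D` lies in every valuation ring containing `t`, so `D` is integral over `F_q[t]`.

If `t` is admissible, the product formula over `F = F_q` gives `n d = r`. Applied to `F_q[t]`,
where the rank is one, it shows that this ring has a single place at infinity, with `‖t‖ = q`.
Finally `‖f(t)‖_v = ‖t‖_v ^ deg f` for nonzero `f` at every place, as `t` has a pole there.
-/

open Polynomial

/-! ### Rings containing the inverse of the variable -/

section RankBound

variable {F K R : Type*} [Field F] [Field K] [Algebra F K] [Algebra F[X] K] [IsScalarTower F F[X] K]
  [CommRing R] [Algebra F R] [Algebra R K] [IsScalarTower F R K]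

/-- Multiplying a polynomial of degree at most `N` in the variable by the `N`-th power of the
inverse `π` of the variable leaves the coefficient of degree `N`, modulo `π`. -/
theorem exists_inv_pow_mul_eq {π : R} (hπ : algebraMap R K π * algebraMap F[X] K X = 1)
    (N : ℕ) (p : F[X]) (hp : p.natDegree ≤ N) :
    ∃ r : R, algebraMap R K π ^ N * algebraMap F[X] K p =
      algebraMap R K (algebraMap F R (p.coeff N) + π * r) := by
  have hC (c : F) : algebraMap F[X] K (C c) = algebraMap R K (algebraMap F R c) := by
    rw [← IsScalarTower.algebraMap_apply, ← Polynomial.algebraMap_eq,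
      ← IsScalarTower.algebraMap_apply]
  induction N generalizing p with
  | zero =>
    rw [Polynomial.eq_C_of_natDegree_le_zero hp]
    exact ⟨0, by simp [hC]⟩
  | succ N ih =>
    obtain ⟨r, hr⟩ := ih p.divX (by rw [natDegree_divX_eq_natDegree_tsub_one]; omega)
    refine ⟨r + π ^ N * algebraMap F R (p.coeff 0), ?_⟩
    conv_lhs => rw [← divX_mul_X_add p]
    rw [coeff_divX] at hr
    simp only [map_add, map_mul, map_pow, hC] at hr ⊢
    linear_combination algebraMap R K π ^ N * algebraMap F[X] K p.divX * hπ + hr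

/-- The bound `∑ e f ≤ [K : F(X)]` in a form which needs no valuations: lifts of elements of `R ⧸
(π)` independent over `F` are independent over `F[X]`. -/
theorem rank_quotient_span_le [FaithfulSMul R K] {π : R}
    (hπ : algebraMap R K π * algebraMap F[X] K X = 1) {r : ℕ} (hr : Module.rank F[X] K ≤ r) :
    Module.rank F (R ⧸ Ideal.span {π}) ≤ r := by
  refine rank_le fun s hs ↦ ?_
  choose x hx using fun i : s ↦ Ideal.Quotient.mk_surjective (i : R ⧸ Ideal.span {π})
  have key : LinearIndependent F[X] fun i : s ↦ algebraMap R K (x i) := by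
    rw [Fintype.linearIndependent_iff]
    classical
    intro g hg
    by_contra! hne
    obtain ⟨i₀, hi₀⟩ := hne
    -- a coefficient of maximal degree survives reduction modulo `π`
    obtain ⟨i₁, hi₁, hmax⟩ := Finset.exists_max_image (Finset.univ.filter fun i ↦ g i ≠ 0)
      (fun i ↦ (g i).natDegree) ⟨i₀, by simp [hi₀]⟩
    set N := (g i₁).natDegree
    have hN (i : s) : (g i).natDegree ≤ N := by
      by_cases h : g i = 0
      · simp [h]
      · exact hmax i (by simp [h])
    choose y hy using fun i ↦ exists_inv_pow_mul_eq (R := R) (K := K) hπ N (g i) (hN i)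
    have h1 : ∑ i, (algebraMap F R ((g i).coeff N) + π * y i) * x i = 0 := by
      apply FaithfulSMul.algebraMap_injective R K
      simp_rw [map_sum, map_mul, ← hy, map_zero]
      rw [← mul_zero (algebraMap R K π ^ N), ← hg, Finset.mul_sum]
      exact Finset.sum_congr rfl fun i _ ↦ by rw [Algebra.smul_def]; ring
    have h2 := congrArg (Ideal.Quotient.mk (Ideal.span {π})) h1
    have hπ0 : Ideal.Quotient.mk (Ideal.span {π}) π = 0 :=
      Ideal.Quotient.eq_zero_iff_mem.mpr (Ideal.mem_span_singleton_self π)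
    simp only [map_sum, map_mul, map_add, hπ0, zero_mul, add_zero, hx, map_zero] at h2
    have h3 := Fintype.linearIndependent_iff.mp hs (fun i ↦ (g i).coeff N) (by
      simpa [Algebra.smul_def] using! h2) i₁
    exact (Finset.mem_filter.mp hi₁).2 (leadingCoeff_eq_zero.mp h3)
  have := key.cardinal_lift_le_rank.trans (Cardinal.lift_le.mpr hr)
  simpa using this

theorem finite_quotient_span [Finite F] [FaithfulSMul R K] {π : R}
    (hπ : algebraMap R K π * algebraMap F[X] K X = 1) {r : ℕ} (hr : Module.rank F[X] K ≤ r) :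
    Finite (R ⧸ Ideal.span {π}) ∧ Nat.card (R ⧸ Ideal.span {π}) ≤ Nat.card F ^ r := by
  have h := rank_quotient_span_le hπ hr
  have hfin : Module.Finite F (R ⧸ Ideal.span {π}) :=
    Module.rank_lt_aleph0_iff.mp (h.trans_lt (Cardinal.natCast_lt_aleph0))
  refine ⟨Module.finite_of_finite F, ?_⟩
  rw [Module.natCard_eq_pow_finrank (K := F)]
  exact Nat.pow_le_pow_right Nat.card_pos (Module.finrank_le_of_rank_le h)

end RankBound

/-! ### Valuation rings not containing the variable -/

section ValuationSubrings

section

variable {K : Type*} [Field K] {V : ValuationSubring K} {x : K}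

theorem ValuationSubring.inv_mem_of_notMem (hx : x ∉ V) : x⁻¹ ∈ V :=
  (V.mem_or_inv_mem _).resolve_left hx

theorem ValuationSubring.inv_mem_maximalIdeal (hx : x ∉ V) :
    (⟨_, V.inv_mem_of_notMem hx⟩ : V) ∈ IsLocalRing.maximalIdeal V := by
  rw [V.valuation_lt_one_iff]
  rw [← V.valuation_le_one_iff, not_le] at hx
  simpa using inv_lt_one_of_one_lt₀ hx

end

variable {F K : Type*} [Field F] [Finite F] [Field K] [Algebra F K]

/-- The elements of a finite field are integral over `ℤ`, so they lie in every valuation ring. -/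
theorem ValuationSubring.algebraMap_mem_of_finite (V : ValuationSubring K) (c : F) :
    algebraMap F K c ∈ V := by
  have h : IsIntegral ℤ c := by
    have := Fintype.ofFinite F
    refine ⟨X ^ Fintype.card F - X, monic_X_pow_sub (by
      rw [degree_X]; exact_mod_cast Fintype.one_lt_card), by simp [FiniteField.pow_card]⟩
  obtain ⟨y, hy⟩ := (IsIntegrallyClosed.isIntegral_iff (R := V) (K := K)).mp
    ((h.map (algebraMap F K).toIntAlgHom).tower_top (A := V))
  exact hy ▸ y.2

theorem ValuationSubring.mem_of_isIntegral_of_finite (V : ValuationSubring K) {x : K}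
    (hx : IsIntegral F x) : x ∈ V := by
  let : Algebra F V := ((algebraMap F K).codRestrict V V.algebraMap_mem_of_finite).toAlgebra
  have : IsScalarTower F V K := .of_algebraMap_eq fun _ ↦ rfl
  obtain ⟨y, hy⟩ := (IsIntegrallyClosed.isIntegral_iff (R := V)).mp (hx.tower_top (A := V))
  exact hy ▸ y.2

theorem ValuationSubring.isTrivialOn_of_finite (V : ValuationSubring K) :
    V.valuation.IsTrivialOn F where
  eq_one c hc := by
    have h1 := (V.valuation_le_one_iff _).mpr (V.algebraMap_mem_of_finite c)
    have h2 := (V.valuation_le_one_iff _).mpr (V.algebraMap_mem_of_finite c⁻¹)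
    rw [map_inv₀, map_inv₀] at h2
    have h0 : 0 < V.valuation (algebraMap F K c) := by simpa [zero_lt_iff] using hc
    exact le_antisymm h1 ((inv_le_one₀ h0).mp h2)

variable [Algebra F[X] K] [IsScalarTower F F[X] K]

theorem ValuationSubring.finite_quotient_span_inv_X {r : ℕ} (hr : Module.rank F[X] K ≤ r)
    {V : ValuationSubring K} (hV : algebraMap F[X] K X ∉ V) :
    Finite (V ⧸ Ideal.span {(⟨_, V.inv_mem_of_notMem hV⟩ : V)}) := by
  let : Algebra F V := ((algebraMap F K).codRestrict V V.algebraMap_mem_of_finite).toAlgebra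
  have : IsScalarTower F V K := .of_algebraMap_eq fun _ ↦ rfl
  have h0 : algebraMap F[X] K X ≠ 0 := fun h ↦ hV (h ▸ V.zero_mem)
  exact (finite_quotient_span (F := F) (K := K) (inv_mul_cancel₀ h0) hr).1

theorem ValuationSubring.finite_residueField {r : ℕ} (hr : Module.rank F[X] K ≤ r)
    {V : ValuationSubring K} (hV : algebraMap F[X] K X ∉ V) :
    Finite (IsLocalRing.ResidueField V) := by
  have := V.finite_quotient_span_inv_X hr hV
  exact .of_surjective _ (Ideal.Quotient.factor_surjective
    ((Ideal.span_singleton_le_iff_mem _).mpr (V.inv_mem_maximalIdeal hV)))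

theorem ValuationSubring.valuation_algebraMap_polynomial {V : ValuationSubring K}
    (hV : algebraMap F[X] K X ∉ V) {p : F[X]} (hp : p ≠ 0) :
    V.valuation (algebraMap F[X] K p) = V.valuation (algebraMap F[X] K X) ^ p.natDegree := by
  have := V.isTrivialOn_of_finite (F := F)
  rw [← V.valuation_le_one_iff, not_le] at hV
  rw [← valuation_aeval_eq_valuation_X_pow_natDegree_of_one_lt_valuation_X (A := F) _ hV hp]
  congr 1
  have h : (IsScalarTower.toAlgHom F F[X] K) = aeval (algebraMap F[X] K X) := by
    ext; simp
  exact DFunLike.congr_fun h p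

/-- Every nonzero ideal contains a power of the inverse of the variable: this is where
algebraicity of `K` over `F[X]` excludes valuations of higher rank. The power is read off from the
constant coefficient of a polynomial relation for `y`. -/
theorem ValuationSubring.exists_inv_X_pow_mem_span [FaithfulSMul F[X] K]
    [Algebra.IsAlgebraic F[X] K] {V : ValuationSubring K}
    (hV : algebraMap F[X] K X ∉ V) {y : V} (hy : y ≠ 0) :
    ∃ m : ℕ, (⟨_, V.inv_mem_of_notMem hV⟩ : V) ^ m ∈ Ideal.span {y} := by
  have h0 : algebraMap F[X] K X ≠ 0 := fun h ↦ hV (h ▸ V.zero_mem)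
  set τ := algebraMap F[X] K X with hτ
  have hy' : (y : K) ≠ 0 := by simpa using hy
  obtain ⟨q, hq0, hq⟩ := (Algebra.IsAlgebraic.isAlgebraic (R := F[X]) (y : K)
    ).exists_nonzero_coeff_and_aeval_eq_zero (mem_nonZeroDivisors_of_ne_zero hy')
  have h1 : 1 < V.valuation τ := by rwa [← not_le, V.valuation_le_one_iff]
  -- `τ⁻¹ ^ N` clears the poles of all coefficients of `q`
  set N := q.support.sup fun i ↦ (q.coeff i).natDegree with hN
  have hle (i : ℕ) : τ⁻¹ ^ N * algebraMap F[X] K (q.coeff i) ∈ V := by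
    by_cases hi : q.coeff i = 0
    · simp [hi]
    rw [← V.valuation_le_one_iff, map_mul, map_pow, map_inv₀,
      V.valuation_algebraMap_polynomial hV hi, inv_pow,
      inv_mul_le_one₀ (pow_pos (zero_lt_one.trans h1) _)]
    exact pow_le_pow_right₀ h1.le
      (Finset.le_sup (f := fun i ↦ (q.coeff i).natDegree) (mem_support_iff.mpr hi))
  refine ⟨N, Ideal.mem_span_singleton.mpr ?_⟩
  have h2 : τ⁻¹ ^ N * algebraMap F[X] K (q.coeff 0) * (y : K)⁻¹ ∈ V := by
    have e : q = q.divX * X + C (q.coeff 0) := (divX_mul_X_add q).symm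
    have e2 := hq
    rw [e] at e2
    simp only [map_add, map_mul, aeval_X, aeval_C] at e2
    have e3 : τ⁻¹ ^ N * algebraMap F[X] K (q.coeff 0) * (y : K)⁻¹ =
        - (τ⁻¹ ^ N * aeval (y : K) q.divX) := by
      field_simp
      linear_combination e2
    rw [e3, aeval_eq_sum_range, Finset.mul_sum]
    refine V.neg_mem _ (sum_mem fun i _ ↦ ?_)
    rw [coeff_divX, Algebra.smul_def, ← mul_assoc]
    exact V.mul_mem _ _ (hle _) (pow_mem y.2 i)
  have h3 : (algebraMap F[X] K (q.coeff 0))⁻¹ ∈ V := by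
    rw [← V.valuation_le_one_iff, map_inv₀, V.valuation_algebraMap_polynomial hV hq0]
    exact inv_le_one_of_one_le₀ (one_le_pow₀ h1.le)
  have hc0 : algebraMap F[X] K (q.coeff 0) ≠ 0 := by
    simpa using hq0
  refine ⟨⟨_, V.mul_mem _ _ h2 h3⟩, Subtype.ext ?_⟩
  simp only [SubmonoidClass.mk_pow, MulMemClass.coe_mul, ← hτ]
  field_simp

/-- A nonzero prime ideal contains the inverse of the variable, and modulo the latter the ring is
finite; so all primes are finitely generated, and the ring is noetherian by Cohen's theorem. -/
theorem ValuationSubring.isDiscreteValuationRing_of_X_notMem [FaithfulSMul F[X] K]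
    [Algebra.IsAlgebraic F[X] K] {r : ℕ} (hr : Module.rank F[X] K ≤ r) {V : ValuationSubring K}
    (hV : algebraMap F[X] K X ∉ V) : IsDiscreteValuationRing V := by
  have hfin := V.finite_quotient_span_inv_X hr hV
  set π : V := ⟨_, V.inv_mem_of_notMem hV⟩ with hπ
  have : IsNoetherianRing V := by
    refine IsNoetherianRing.of_prime fun P hP ↦ ?_
    by_cases h : P = ⊥
    · exact h ▸ Submodule.fg_bot
    obtain ⟨y, hyP, hy⟩ := Submodule.exists_mem_ne_zero_of_ne_bot h
    obtain ⟨m, hm⟩ := V.exists_inv_X_pow_mem_span hV hy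
    have hπP : Ideal.span {π} ≤ P := (Ideal.span_singleton_le_iff_mem _).mpr
      (hP.mem_of_pow_mem m ((Ideal.span_singleton_le_iff_mem _).mpr hyP hm))
    refine Submodule.fg_of_fg_map_of_fg_inf_ker (Submodule.mkQ (Ideal.span {π})) ?_ ?_
    · have : Finite (V ⧸ Ideal.span {π}) := hfin
      exact IsNoetherian.noetherian _
    · rw [Submodule.ker_mkQ, inf_eq_right.mpr hπP]
      exact Submodule.fg_span_singleton _
  refine ((IsDiscreteValuationRing.TFAE V fun hF ↦ ?_).out 0 1).mpr
    (inferInstance : ValuationRing V)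
  have h0 : algebraMap F[X] K X ≠ 0 := fun h ↦ hV (h ▸ V.zero_mem)
  have h1 := (IsLocalRing.isField_iff_maximalIdeal_eq.mp hF) ▸ V.inv_mem_maximalIdeal hV
  exact h0 (by simpa using congrArg Subtype.val ((Submodule.mem_bot _).mp h1))

end ValuationSubrings

namespace PlaceAtInfinity

/-! ### The absolute value of a place -/

section AbsoluteValue

open NNReal

variable {D : Type*} [CommRing D] [IsDomain D] (v : PlaceAtInfinity D) [Finite v.residueField]

theorem one_lt_card_residueField : (1 : ℝ≥0) < Nat.card v.residueField := by
  exact_mod_cast Finite.one_lt_card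

/-- The absolute value `(#F(v)) ^ (-v(x))` on `Frac D` attached to a place `v` with finite residue
field; it extends the norm of the place from `D` to `Frac D`. -/
noncomputable def absVal : AbsoluteValue (FractionRing D) ℝ :=
  (IsDiscreteValuationRing.maximalIdeal v.ring).adicAbv v.one_lt_card_residueField

theorem isNonarchimedean_absVal : IsNonarchimedean v.absVal :=
  IsDedekindDomain.HeightOneSpectrum.isNonarchimedean_adicAbv _ v.one_lt_card_residueField

theorem absVal_eq_zpow_ord {x : FractionRing D} (hx : x ≠ 0) :
    v.absVal x = (Nat.card v.residueField : ℝ) ^ (-v.ord x) := by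
  have h0 : (IsDiscreteValuationRing.maximalIdeal v.ring).valuation (FractionRing D) x ≠ 0 := by
    simpa using hx
  rw [absVal, ord, neg_neg]
  change ((WithZeroMulInt.toNNReal (ne_zero_of_lt v.one_lt_card_residueField)
    ((IsDiscreteValuationRing.maximalIdeal v.ring).valuation (FractionRing D) x) : ℝ≥0) : ℝ) = _
  rw [WithZeroMulInt.toNNReal_neg_apply _ h0]
  push_cast
  congr 1
  rw [← WithZero.coe_inj.mp ((WithZero.exp_log h0).trans (WithZero.coe_unzero h0).symm)]
  rfl

theorem norm_eq_absVal (a : D) : v.norm a = v.absVal (algebraMap D (FractionRing D) a) := by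
  unfold norm
  split_ifs with h
  · simp [h]
  · rw [absVal_eq_zpow_ord _ (by simpa using h), one_div, inv_zpow']

theorem absVal_coe_le_one (x : v.ring) : v.absVal x ≤ 1 :=
  IsDedekindDomain.HeightOneSpectrum.adicAbv_coe_le_one _ v.one_lt_card_residueField x

theorem absVal_coe_lt_one_iff {x : v.ring} :
    v.absVal x < 1 ↔ x ∈ IsLocalRing.maximalIdeal v.ring :=
  IsDedekindDomain.HeightOneSpectrum.adicAbv_coe_lt_one_iff _ v.one_lt_card_residueField x

theorem absVal_le_one_iff {x : FractionRing D} : v.absVal x ≤ 1 ↔ x ∈ v.ring := by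
  refine ⟨fun h ↦ ?_, fun h ↦ v.absVal_coe_le_one ⟨x, h⟩⟩
  by_contra hx
  have h1 := v.absVal_coe_lt_one_iff.mpr (v.ring.inv_mem_maximalIdeal hx)
  have h0 : 0 < v.absVal x := v.absVal.pos fun h0 ↦ hx (h0 ▸ v.ring.zero_mem)
  rw [map_inv₀] at h1
  exact absurd h1 (not_lt.mpr (one_le_inv₀ h0 |>.mpr h))

theorem absVal_eq_one_of_isIntegral {F : Type*} [Field F] [Finite F] [Algebra F (FractionRing D)]
    {x : FractionRing D} (hx : IsIntegral F x) (h0 : x ≠ 0) : v.absVal x = 1 := by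
  have h1 := v.absVal_le_one_iff.mpr (v.ring.mem_of_isIntegral_of_finite hx)
  have h2 := v.absVal_le_one_iff.mpr (v.ring.mem_of_isIntegral_of_finite hx.inv)
  rw [map_inv₀] at h2
  exact le_antisymm h1 ((inv_le_one₀ (v.absVal.pos h0)).mp h2)

theorem exists_absVal_eq_pow (n : ℕ) :
    ∃ x, v.absVal x = (Nat.card v.residueField : ℝ) ^ n := by
  obtain ⟨x, hx⟩ := (IsDiscreteValuationRing.maximalIdeal v.ring).valuation_surjective
    (FractionRing D) (WithZero.exp (n : ℤ))
  have h0 : x ≠ 0 := by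
    rintro rfl
    exact WithZero.exp_ne_zero (hx.symm.trans (map_zero _))
  refine ⟨x, ?_⟩
  rw [absVal_eq_zpow_ord _ h0, ord, hx]
  simp

theorem isNontrivial_absVal : v.absVal.IsNontrivial := by
  obtain ⟨x, hx⟩ := v.exists_absVal_eq_pow 1
  have h1 : (1 : ℝ) < Nat.card v.residueField := by exact_mod_cast v.one_lt_card_residueField
  rw [pow_one] at hx
  refine ⟨x, ?_, by rw [hx]; exact h1.ne'⟩
  rintro rfl
  rw [map_zero] at hx
  linarith

theorem ext_ring {v w : PlaceAtInfinity D} (h : v.ring = w.ring) : v = w := by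
  cases v; cases w; congr

theorem not_isEquiv_absVal {v w : PlaceAtInfinity D} [Finite v.residueField]
    [Finite w.residueField] (h : v ≠ w) : ¬ v.absVal.IsEquiv w.absVal := fun H ↦
  h <| ext_ring <| by ext x; rw [← absVal_le_one_iff, ← absVal_le_one_iff, H.le_one_iff]

/-- The quotient of the valuation ring by an element of order `n` has `n` steps, each isomorphic
to the residue field. -/
theorem card_quotient_span {x : FractionRing D} (hx : x ∈ v.ring) (h0 : x ≠ 0) :
    (Nat.card (v.ring ⧸ Ideal.span {(⟨x, hx⟩ : v.ring)}) : ℝ) = (v.absVal x)⁻¹ := by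
  obtain ⟨ϖ, hϖ⟩ := IsDiscreteValuationRing.exists_irreducible v.ring
  have hne : (⟨x, hx⟩ : v.ring) ≠ 0 := fun h ↦ h0 (congrArg Subtype.val h)
  obtain ⟨n, hn⟩ := IsDiscreteValuationRing.associated_pow_irreducible hne hϖ
  have hm := (IsDiscreteValuationRing.irreducible_iff_uniformizer ϖ).mp hϖ
  have hspan : Ideal.span {(⟨x, hx⟩ : v.ring)} = IsLocalRing.maximalIdeal v.ring ^ n := by
    rw [hm, Ideal.span_singleton_pow, Ideal.span_singleton_eq_span_singleton]
    exact hn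
  have hcard := cardQuot_pow_of_prime (P := IsLocalRing.maximalIdeal v.ring) (i := n)
    (IsDiscreteValuationRing.not_a_field v.ring)
  rw [Submodule.cardQuot_apply, Submodule.cardQuot_apply] at hcard
  rw [hspan, hcard, absVal_eq_zpow_ord _ h0, ord, neg_neg]
  have hval : (IsDiscreteValuationRing.maximalIdeal v.ring).valuation (FractionRing D) x =
      WithZero.exp (-(n : ℤ)) := by
    have e : x = algebraMap v.ring (FractionRing D) ⟨x, hx⟩ := rfl
    rw [e, IsDedekindDomain.HeightOneSpectrum.valuation_of_algebraMap]
    obtain ⟨u, hu⟩ := hn.symm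
    rw [← hu, map_mul, map_pow, IsDedekindDomain.HeightOneSpectrum.intValuation_singleton _
      hϖ.ne_zero hm, ← IsDedekindDomain.HeightOneSpectrum.valuation_of_algebraMap
      (K := FractionRing D), (IsDedekindDomain.HeightOneSpectrum.valuation_eq_one_iff_notMem
      _).mpr]
    · rw [mul_one, ← WithZero.exp_nsmul]; simp
    · exact fun h ↦ (IsLocalRing.mem_maximalIdeal _).mp h u.isUnit
  rw [hval]
  simp [residueField, IsLocalRing.ResidueField]

/-- Weak approximation for finitely many distinct places. -/
theorem exists_forall_absVal_sub_lt {ι : Type*} [Finite ι] {u : ι → PlaceAtInfinity D}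
    [∀ i, Finite (u i).residueField] (hu : Function.Injective u) (y : ι → FractionRing D)
    {ε : ℝ} (hε : 0 < ε) : ∃ x, ∀ i, (u i).absVal (x - y i) < ε := by
  have := Fintype.ofFinite ι
  obtain ⟨x, hx⟩ := (Metric.denseRange_iff.mp (AbsoluteValue.denseRange_algebraMap_pi
    (v := fun i ↦ (u i).absVal) (fun i ↦ (u i).isNontrivial_absVal)
    fun i j hij ↦ not_isEquiv_absVal (hu.ne hij))) (fun i ↦ WithAbs.toAbs _ (y i)) ε hε
  refine ⟨x, fun i ↦ ?_⟩
  have := (dist_pi_lt_iff hε).mp hx i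
  rw [dist_comm, dist_eq_norm] at this
  exact this

end AbsoluteValue

end PlaceAtInfinity

/-- The valuative criterion of integrality. -/
theorem isIntegral_of_forall_valuationSubring {A K : Type*} [CommRing A] [Field K] [Algebra A K]
    {x : K} (h : ∀ V : ValuationSubring K, (algebraMap A K).range ≤ V.toSubring → x ∈ V) :
    IsIntegral A x := by
  by_contra hx
  have : IsIntegrallyClosedIn (integralClosure A K).toSubring K :=
    inferInstanceAs (IsIntegrallyClosedIn (integralClosure A K) K)
  obtain ⟨V, hV, hxV⟩ := Subring.exists_le_valuationSubring_of_isIntegrallyClosedIn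
    (R := (integralClosure A K).toSubring) (x := x) hx
  refine hxV (h V fun _ ⟨a, ha⟩ ↦ hV (ha ▸ (integralClosure A K).algebraMap_mem a))

namespace PlaceAtInfinity

/-! ### Intersections of valuation rings of places -/

section Intersection

variable {D : Type*} [CommRing D] [IsDomain D] {ι : Type*} (u : ι → PlaceAtInfinity D)

/-- The intersection of the valuation rings of a family of places. -/
def commonRing : Subring (FractionRing D) := ⨅ i, (u i).ring.toSubring

variable {u}

theorem mem_commonRing {x : FractionRing D} : x ∈ commonRing u ↔ ∀ i, x ∈ (u i).ring := by
  simp [commonRing, Subring.mem_iInf]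

/-- The quotient of the intersection by `π` is the product of the quotients of the valuation rings
by `π`: injectivity is clear, and surjectivity is weak approximation. -/
theorem card_quotient_commonRing [Fintype ι] [∀ i, Finite (u i).residueField]
    (hu : Function.Injective u) {π : commonRing u} (h0 : π ≠ 0) :
    (Nat.card (commonRing u ⧸ Ideal.span {π}) : ℝ) =
      ∏ i, ((u i).absVal (π : FractionRing D))⁻¹ := by
  have hle (i : ι) : commonRing u ≤ (u i).ring.toSubring := iInf_le _ i
  have h0' : (π : FractionRing D) ≠ 0 := by simpa using h0
  let f (i : ι) : commonRing u →+* (u i).ring := Subring.inclusion (hle i)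
  let φ : commonRing u →+* ∀ i, (u i).ring ⧸ Ideal.span {f i π} :=
    RingHom.pi fun i ↦ (Ideal.Quotient.mk _).comp (f i)
  have hdvd (i : ι) (x : (u i).ring) :
      x ∈ Ideal.span {f i π} ↔ (x : FractionRing D) / π ∈ (u i).ring := by
    rw [Ideal.mem_span_singleton]
    constructor
    · rintro ⟨c, rfl⟩
      convert c.2
      change (π : FractionRing D) * c / π = c
      field_simp
    · intro h
      refine ⟨⟨_, h⟩, Subtype.ext ?_⟩
      change (x : FractionRing D) = π * (x / π)
      field_simp
  have hker : RingHom.ker φ = Ideal.span {π} := by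
    ext x
    have h1 : x ∈ RingHom.ker φ ↔ ∀ i, f i x ∈ Ideal.span {f i π} := by
      rw [RingHom.mem_ker, funext_iff]
      exact forall_congr' fun i ↦ Ideal.Quotient.eq_zero_iff_mem
    rw [h1, Ideal.mem_span_singleton]
    constructor
    · intro h
      refine ⟨⟨(x : FractionRing D) / π, mem_commonRing.mpr fun i ↦ (hdvd i _).mp (h i)⟩,
        Subtype.ext ?_⟩
      change (x : FractionRing D) = π * (x / π)
      field_simp
    · rintro ⟨c, rfl⟩ i
      rw [map_mul]
      exact Ideal.mul_mem_right _ _ (Ideal.mem_span_singleton_self _)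
  have hsurj : Function.Surjective φ := by
    intro y
    choose z hz using fun i ↦ Ideal.Quotient.mk_surjective (y i)
    -- the `x` sought has to approximate each `z i` to within the absolute value of `π`
    have hε : ∃ ε > 0, ∀ i, ε ≤ (u i).absVal (π : FractionRing D) := by
      cases isEmpty_or_nonempty ι
      · exact ⟨1, one_pos, fun i ↦ isEmptyElim i⟩
      · obtain ⟨j, hj⟩ := Finite.exists_min fun i ↦ (u i).absVal (π : FractionRing D)
        exact ⟨_, (u j).absVal.pos h0', hj⟩
    obtain ⟨ε, hε0, hε⟩ := hε
    obtain ⟨x, hx⟩ := exists_forall_absVal_sub_lt hu (fun i ↦ (z i : FractionRing D)) hε0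
    have hxz (i : ι) : (x - z i) / π ∈ (u i).ring := by
      rw [← absVal_le_one_iff, map_div₀, div_le_one ((u i).absVal.pos h0')]
      exact (hx i).le.trans (hε i)
    have hxR : x ∈ commonRing u := by
      refine mem_commonRing.mpr fun i ↦ ?_
      have h2 : x = (x - z i) / π * (f i π : (u i).ring) + z i := by
        change x = (x - z i) / π * π + z i
        field_simp
        ring
      rw [h2]
      exact (u i).ring.add_mem _ _ ((u i).ring.mul_mem _ _ (hxz i) (f i π).2) (z i).2
    refine ⟨⟨x, hxR⟩, funext fun i ↦ ?_⟩
    rw [← hz i]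
    exact Ideal.Quotient.eq.mpr ((hdvd i _).mpr (hxz i))
  rw [← Nat.card_congr ((Ideal.quotEquivOfEq hker).symm.trans
    (RingHom.quotientKerEquivOfSurjective hsurj)).symm.toEquiv, Nat.card_pi, Nat.cast_prod]
  exact Finset.prod_congr rfl fun i _ ↦ card_quotient_span (u i) _ h0'

end Intersection

/-! ### Places at infinity of a finite extension of a polynomial ring -/

section FiniteExtension

variable {F D : Type*} [Field F] [CommRing D] [IsDomain D] [Algebra F[X] D]

theorem rank_fractionRing_le [Module.Finite F[X] D] [FaithfulSMul F[X] D] :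
    Module.rank F[X] (FractionRing D) ≤ (Module.finrank F[X] D : ℕ) := by
  rw [Module.finrank_eq_rank]
  exact (IsLocalizedModule.rank_eq (nonZeroDivisors F[X]) le_rfl
    (IsScalarTower.toAlgHom F[X] D (FractionRing D)).toLinearMap).le

instance isAlgebraic_fractionRing [Module.Finite F[X] D] [FaithfulSMul F[X] D] :
    Algebra.IsAlgebraic F[X] (FractionRing D) :=
  have : Algebra.IsAlgebraic D (FractionRing D) := IsLocalization.isAlgebraic _ (nonZeroDivisors D)
  .trans F[X] D (FractionRing D)

variable [Finite F] [Algebra F D] [IsScalarTower F F[X] D] [Module.Finite F[X] D]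

/-- A valuation ring containing the variable contains `F[X]`, hence the integral extension `D`. -/
theorem range_le_of_X_mem {V : ValuationSubring (FractionRing D)}
    (h : algebraMap F[X] (FractionRing D) X ∈ V) :
    (algebraMap D (FractionRing D)).range ≤ V.toSubring := by
  have hmem (p : F[X]) : algebraMap F[X] (FractionRing D) p ∈ V := by
    induction p using Polynomial.induction_on' with
    | add p q hp hq =>
      rw [map_add]
      exact V.add_mem _ _ hp hq
    | monomial n a =>
      rw [← C_mul_X_pow_eq_monomial, map_mul, map_pow, ← Polynomial.algebraMap_eq,
        ← IsScalarTower.algebraMap_apply]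
      exact V.mul_mem _ _ (V.algebraMap_mem_of_finite a) (pow_mem h n)
  let : Algebra F[X] V :=
    ((algebraMap F[X] (FractionRing D)).codRestrict V hmem).toAlgebra
  have : IsScalarTower F[X] V (FractionRing D) := .of_algebraMap_eq fun _ ↦ rfl
  rintro _ ⟨x, rfl⟩
  have hx : IsIntegral F[X] (algebraMap D (FractionRing D) x) :=
    (Algebra.IsIntegral.isIntegral x).algebraMap
  obtain ⟨y, hy⟩ := (IsIntegrallyClosed.isIntegral_iff (R := V)).mp (hx.tower_top (A := V))
  exact hy ▸ y.2

theorem X_notMem_ring (v : PlaceAtInfinity D) : algebraMap F[X] (FractionRing D) X ∉ v.ring :=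
  fun h ↦ v.not_contains (range_le_of_X_mem h)

variable (F) in
theorem one_lt_absVal_X (v : PlaceAtInfinity D) [Finite v.residueField] :
    1 < v.absVal (algebraMap F[X] (FractionRing D) X) := by
  rw [← not_le, absVal_le_one_iff]
  exact v.X_notMem_ring

theorem absVal_algebraMap_polynomial (v : PlaceAtInfinity D) [Finite v.residueField] {p : F[X]}
    (hp : p ≠ 0) : v.absVal (algebraMap F[X] (FractionRing D) p) =
      v.absVal (algebraMap F[X] (FractionRing D) X) ^ p.natDegree := by
  have h1 := v.X_notMem_ring (F := F)
  have h2 := v.ring.valuation_algebraMap_polynomial h1 hp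
  rw [← map_pow, v.ring.valuation_eq_iff] at h2
  obtain ⟨u, hu⟩ := h2
  rw [← map_pow, ← hu, map_mul]
  have hu1 : v.absVal (u : v.ring) = 1 := by
    refine le_antisymm (v.absVal_coe_le_one _) (not_lt.mp fun h ↦ ?_)
    exact (IsLocalRing.mem_maximalIdeal _).mp (v.absVal_coe_lt_one_iff.mp h) u.isUnit
  rw [hu1, one_mul]

variable [FaithfulSMul F[X] D]

/-- A valuation ring of `Frac D` not containing the variable is discrete, hence a place at
infinity. -/
noncomputable def ofXNotMem (V : ValuationSubring (FractionRing D))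
    (hV : algebraMap F[X] (FractionRing D) X ∉ V) : PlaceAtInfinity D where
  ring := V
  isDVR := V.isDiscreteValuationRing_of_X_notMem rank_fractionRing_le hV
  not_contains h := hV <| by
    rw [IsScalarTower.algebraMap_apply F[X] D]
    exact h ⟨_, rfl⟩

variable (F) in
include F in
theorem finite_residueField (v : PlaceAtInfinity D) : Finite v.residueField :=
  v.ring.finite_residueField rank_fractionRing_le (v.X_notMem_ring (F := F))

variable (F) in
/-- An element of `D` without poles at infinity has no poles at all, so it is a constant. -/
theorem isIntegral_of_forall_mem {a : D}
    (ha : ∀ v : PlaceAtInfinity D, algebraMap D (FractionRing D) a ∈ v.ring) : IsIntegral F a := by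
  refine (isIntegral_algebraMap_iff (IsFractionRing.injective D (FractionRing D))).mp
    (isIntegral_of_forall_valuationSubring fun V _ ↦ ?_)
  by_cases hV : algebraMap F[X] (FractionRing D) X ∈ V
  · exact range_le_of_X_mem hV ⟨a, rfl⟩
  · exact ha (ofXNotMem V hV)

variable (F D) in
include F in
/-- Without places at infinity the variable would be a constant. -/
theorem nonempty_of_finite : Nonempty (PlaceAtInfinity D) := by
  by_contra h
  rw [not_nonempty_iff] at h
  have h1 : IsIntegral F (algebraMap F[X] D X) := isIntegral_of_forall_mem F fun v ↦ isEmptyElim v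
  have h2 : IsIntegral F (X : F[X]) :=
    (isIntegral_algebraMap_iff (FaithfulSMul.algebraMap_injective F[X] D)).mp h1
  exact transcendental_X F h2.isAlgebraic

end FiniteExtension

end PlaceAtInfinity

namespace PlaceAtInfinity

/-! ### The product formula -/

section ProductFormula

variable (F : Type*) {D : Type*} [Field F] [Finite F] [CommRing D] [IsDomain D] [Algebra F D]
  [Algebra F[X] D] [IsScalarTower F F[X] D] [Module.Finite F[X] D]

theorem inv_X_mem_commonRing {ι : Type*} (u : ι → PlaceAtInfinity D) :
    (algebraMap F[X] (FractionRing D) X)⁻¹ ∈ commonRing u :=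
  mem_commonRing.mpr fun i ↦ ValuationSubring.inv_mem_of_notMem (u i).X_notMem_ring

/-- The elements of `D` whose pole at each place has order at most `m - 1` times that of the
variable. The inequality is multiplied through by the absolute value of the variable, so that
the exponent is a natural number also for `m = 0`. -/
def boundedPoles (D : Type*) [CommRing D] [IsDomain D] [Algebra F[X] D]
    [∀ v : PlaceAtInfinity D, Finite v.residueField] (m : ℕ) : AddSubgroup D where
  carrier := {a | ∀ v : PlaceAtInfinity D, v.absVal (algebraMap D (FractionRing D) a) *
    v.absVal (algebraMap F[X] (FractionRing D) X) ≤
      v.absVal (algebraMap F[X] (FractionRing D) X) ^ m}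
  zero_mem' v := by simp
  neg_mem' {a} ha v := by simpa using ha v
  add_mem' {a b} ha hb v := by
    rw [map_add]
    refine (mul_le_mul_of_nonneg_right (v.isNonarchimedean_absVal _ _)
      (v.absVal.nonneg _)).trans ?_
    rw [max_mul_of_nonneg _ _ (v.absVal.nonneg _)]
    exact max_le (ha v) (hb v)

theorem smul_mem_boundedPoles [∀ v : PlaceAtInfinity D, Finite v.residueField]
    {p : F[X]} {m c : ℕ} (hp : p.degree < m) {a : D}
    (ha : a ∈ boundedPoles F D c) : p • a ∈ boundedPoles F D (m + c) := by
  intro v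
  by_cases h0 : p = 0
  · simp [h0]
  have h1 := one_lt_absVal_X F v
  rw [Algebra.smul_def, map_mul, ← IsScalarTower.algebraMap_apply, map_mul,
    v.absVal_algebraMap_polynomial h0, mul_assoc, pow_add]
  exact mul_le_mul (pow_le_pow_right₀ h1.le ((natDegree_lt_iff_degree_lt h0).mpr hp).le) (ha v)
    (by positivity) (by positivity)

variable [FaithfulSMul F[X] D]

theorem finite_quotient_commonRing {ι : Type*} (u : ι → PlaceAtInfinity D) :
    Finite (commonRing u ⧸ Ideal.span {(⟨_, inv_X_mem_commonRing F u⟩ : commonRing u)}) ∧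
    Nat.card (commonRing u ⧸ Ideal.span {(⟨_, inv_X_mem_commonRing F u⟩ : commonRing u)}) ≤
      Nat.card F ^ Module.finrank F[X] D := by
  let : Algebra F (commonRing u) := ((algebraMap F (FractionRing D)).codRestrict (commonRing u)
    fun c ↦ mem_commonRing.mpr fun i ↦ (u i).ring.algebraMap_mem_of_finite c).toAlgebra
  have : IsScalarTower F (commonRing u) (FractionRing D) := .of_algebraMap_eq fun _ ↦ rfl
  exact finite_quotient_span (F := F) (K := FractionRing D)
    (inv_mul_cancel₀ (by simp)) rank_fractionRing_le

theorem prod_absVal_X_eq_card {ι : Type*} [Fintype ι] {u : ι → PlaceAtInfinity D}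
    [∀ i, Finite (u i).residueField] (hu : Function.Injective u) :
    ∏ i, (u i).absVal (algebraMap F[X] (FractionRing D) X) =
      Nat.card (commonRing u ⧸
        Ideal.span {(⟨_, inv_X_mem_commonRing F u⟩ : commonRing u)}) := by
  rw [card_quotient_commonRing hu]
  · simp
  · simp [Subtype.ext_iff]

theorem two_le_absVal_X (v : PlaceAtInfinity D) [Finite v.residueField] :
    2 ≤ v.absVal (algebraMap F[X] (FractionRing D) X) := by
  have h1 := one_lt_absVal_X F v
  have h2 := v.card_quotient_span
    (ValuationSubring.inv_mem_of_notMem (v.X_notMem_ring (F := F)))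
    (inv_ne_zero (by simp))
  rw [map_inv₀, inv_inv] at h2
  rw [← h2] at h1 ⊢
  exact_mod_cast h1

variable (D) in
include F in
/-- There are only finitely many places at infinity, because the product of the values of the
variable over any finite set of them is bounded, and each value is at least `2`. -/
theorem finite_of_finite : Finite (PlaceAtInfinity D) := by
  have (v : PlaceAtInfinity D) := v.finite_residueField F
  refine (fintypeOfFinsetCardLe (Nat.card F ^ Module.finrank F[X] D) fun s ↦ ?_).finite
  have h1 := prod_absVal_X_eq_card F (u := fun v : s ↦ (v : PlaceAtInfinity D))
    Subtype.val_injective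
  have h2 := (finite_quotient_commonRing F fun v : s ↦ (v : PlaceAtInfinity D)).2
  have h3 : (2 : ℝ) ^ s.card ≤
      ∏ v : s, (v : PlaceAtInfinity D).absVal (algebraMap F[X] (FractionRing D) X) := by
    have := Finset.prod_le_prod (s := Finset.univ) (f := fun _ : s ↦ (2 : ℝ))
      (fun _ _ ↦ zero_le_two) fun v _ ↦ two_le_absVal_X F (v : PlaceAtInfinity D)
    simpa using this
  rw [h1] at h3
  have h4 : 2 ^ s.card ≤ Nat.card F ^ Module.finrank F[X] D := le_trans (by exact_mod_cast h3) h2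
  exact Nat.lt_two_pow_self.le.trans h4

variable [∀ v : PlaceAtInfinity D, Finite v.residueField]

theorem boundedPoles_zero : boundedPoles F D 0 = ⊥ := by
  refine (AddSubgroup.eq_bot_iff_forall _).mpr fun a ha ↦ ?_
  by_contra h0
  obtain ⟨v⟩ := nonempty_of_finite F D
  have hlt (v : PlaceAtInfinity D) : v.absVal (algebraMap D (FractionRing D) a) < 1 := by
    have h1 := one_lt_absVal_X F v
    have h2 := ha v
    rw [pow_zero] at h2
    by_contra! h3
    nlinarith
  have h1 : IsIntegral F a := isIntegral_of_forall_mem F fun v ↦ v.absVal_le_one_iff.mp (hlt v).le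
  exact (hlt v).ne (v.absVal_eq_one_of_isIntegral (F := F) h1.algebraMap (by simpa using h0))

/-- Each step of the filtration by the order of the poles embeds into the quotient of the
intersection of all valuation rings by the inverse of the variable. -/
theorem card_boundedPoles_le (m : ℕ) : Finite (boundedPoles F D m) ∧
    Nat.card (boundedPoles F D m) ≤
      Nat.card (commonRing (id : PlaceAtInfinity D → PlaceAtInfinity D) ⧸
        Ideal.span {(⟨_, inv_X_mem_commonRing F id⟩ :
          commonRing (id : PlaceAtInfinity D → PlaceAtInfinity D))}) ^ m := by
  induction m with
  | zero =>
    rw [boundedPoles_zero]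
    exact ⟨inferInstance, by simp⟩
  | succ m ih =>
    obtain ⟨ihf, ih⟩ := ih
    have hfin := (finite_quotient_commonRing F (id : PlaceAtInfinity D → PlaceAtInfinity D)).1
    have hmem (a : boundedPoles F D (m + 1)) :
        (algebraMap F[X] (FractionRing D) X)⁻¹ ^ m * algebraMap D (FractionRing D) a ∈
          commonRing (id : PlaceAtInfinity D → PlaceAtInfinity D) := by
      refine mem_commonRing.mpr fun v ↦ ?_
      have h1 := a.2 v
      have h0 := zero_lt_one.trans (one_lt_absVal_X F v)
      rw [id, ← absVal_le_one_iff, map_mul, map_pow, map_inv₀, inv_pow,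
        inv_mul_le_one₀ (pow_pos h0 _)]
      rw [pow_succ] at h1
      exact le_of_mul_le_mul_right h1 h0
    let f : boundedPoles F D (m + 1) →+ commonRing (id : PlaceAtInfinity D → PlaceAtInfinity D) ⧸
        Ideal.span {(⟨_, inv_X_mem_commonRing F id⟩ :
          commonRing (id : PlaceAtInfinity D → PlaceAtInfinity D))} :=
      (Ideal.Quotient.mk _).toAddMonoidHom.comp
        { toFun a := ⟨_, hmem a⟩
          map_zero' := by simp [Subtype.ext_iff]
          map_add' a b := by simp [mul_add] }
    have hker (a : f.ker) : ((a : boundedPoles F D (m + 1)) : D) ∈ boundedPoles F D m := by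
      obtain ⟨c, hc⟩ := Ideal.mem_span_singleton.mp (Ideal.Quotient.eq_zero_iff_mem.mp a.2)
      have hc' : (algebraMap F[X] (FractionRing D) X)⁻¹ ^ m *
          algebraMap D (FractionRing D) (a : boundedPoles F D (m + 1)) =
        (algebraMap F[X] (FractionRing D) X)⁻¹ * c := congrArg Subtype.val hc
      intro v
      have h0 := zero_lt_one.trans (one_lt_absVal_X F v)
      have h1 := congrArg v.absVal hc'
      simp only [map_mul, map_pow, map_inv₀, inv_pow] at h1
      have h2 := v.absVal_le_one_iff.mpr (mem_commonRing.mp c.2 v)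
      have h3 : v.absVal (algebraMap D (FractionRing D) (a : boundedPoles F D (m + 1))) *
            v.absVal (algebraMap F[X] (FractionRing D) X) =
          v.absVal (algebraMap F[X] (FractionRing D) X) ^ m * v.absVal c := by
        field_simp at h1
        linear_combination h1
      rw [h3]
      exact mul_le_of_le_one_right (by positivity) h2
    have hinj : Function.Injective fun a : f.ker ↦ (⟨_, hker a⟩ : boundedPoles F D m) := by
      intro a b hab
      exact Subtype.ext (Subtype.ext (Subtype.mk.inj hab))
    have hkerf : Finite f.ker := .of_injective _ hinj
    have hf : Finite (boundedPoles F D (m + 1)) := by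
      have : Finite (boundedPoles F D (m + 1) ⧸ f.ker) :=
        .of_equiv _ (QuotientAddGroup.quotientKerEquivRange f).symm.toEquiv
      exact .of_equiv _ (AddSubgroup.addGroupEquivQuotientProdAddSubgroup (s := f.ker)).symm
    refine ⟨hf, ?_⟩
    rw [AddSubgroup.card_eq_card_quotient_mul_card_addSubgroup f.ker, pow_succ,
      Nat.card_congr (QuotientAddGroup.quotientKerEquivRange f).toEquiv, mul_comm]
    exact Nat.mul_le_mul ((Nat.card_le_card_of_injective _ hinj).trans ih)
      (Nat.card_le_card_of_injective _ Subtype.val_injective)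

theorem exists_forall_mem_boundedPoles {ι : Type*} [Finite ι] (b : ι → D) :
    ∃ c, ∀ i, b i ∈ boundedPoles F D c := by
  have := finite_of_finite F D
  have h (x : ι × PlaceAtInfinity D) : ∃ c : ℕ,
      x.2.absVal (algebraMap D (FractionRing D) (b x.1)) *
        x.2.absVal (algebraMap F[X] (FractionRing D) X) <
      x.2.absVal (algebraMap F[X] (FractionRing D) X) ^ c :=
    pow_unbounded_of_one_lt _ (one_lt_absVal_X F x.2)
  choose c hc using h
  obtain ⟨C, hC⟩ := (Set.finite_range c).bddAbove
  exact ⟨C, fun i v ↦ (hc (i, v)).le.trans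
    (pow_le_pow_right₀ (one_lt_absVal_X F v).le (hC ⟨_, rfl⟩))⟩

/-- The product formula for the variable: the sum of the local degrees `e_v f_v` over the places at
infinity is the rank of `D` over the polynomial ring. -/
theorem prod_absVal_X [Fintype (PlaceAtInfinity D)] :
    ∏ v : PlaceAtInfinity D, v.absVal (algebraMap F[X] (FractionRing D) X) =
      (Nat.card F : ℝ) ^ Module.finrank F[X] D := by
  have h1 := prod_absVal_X_eq_card F (D := D) (u := id) Function.injective_id
  obtain ⟨hfin, h2⟩ := finite_quotient_commonRing F (id : PlaceAtInfinity D → PlaceAtInfinity D)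
  have h3 := card_boundedPoles_le F (D := D)
  refine h1.trans ?_
  set N := Nat.card (commonRing (id : PlaceAtInfinity D → PlaceAtInfinity D) ⧸
        Ideal.span {(⟨_, inv_X_mem_commonRing F id⟩ :
          commonRing (id : PlaceAtInfinity D → PlaceAtInfinity D))})
  have hN : 0 < N := Nat.card_pos
  set r := Module.finrank F[X] D
  let b := Module.finBasis F[X] D
  obtain ⟨c, hc⟩ := exists_forall_mem_boundedPoles F b
  -- combinations of the basis with coefficients of degree less than `m`
  have hlow (m : ℕ) : Nat.card F ^ (r * m) ≤ N ^ (m + c) := by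
    obtain ⟨hf, h4⟩ := h3 (m + c)
    refine le_trans ?_ h4
    let g (x : Fin r → degreeLT F m) : boundedPoles F D (m + c) :=
      ⟨∑ i, (x i : F[X]) • b i, sum_mem fun i _ ↦
        smul_mem_boundedPoles F (mem_degreeLT.mp (x i).2) (hc i)⟩
    have hg : Function.Injective g := by
      intro x y hxy
      have h5 : ∑ i, (x i : F[X]) • b i = ∑ i, (y i : F[X]) • b i := congrArg Subtype.val hxy
      have h6 : (fun i ↦ (x i : F[X])) = fun i ↦ (y i : F[X]) :=
        b.equivFun.symm.injective (by simpa only [Module.Basis.equivFun_symm_apply] using h5)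
      exact funext fun i ↦ Subtype.ext (congrFun h6 i)
    refine le_of_eq_of_le ?_ (Nat.card_le_card_of_injective g hg)
    rw [Nat.card_fun, Nat.card_congr (degreeLTEquiv F m).toEquiv, Nat.card_fun]
    simp [← pow_mul, mul_comm]
  have hle : N ≤ Nat.card F ^ r := h2
  have hge : Nat.card F ^ r ≤ N := by
    by_contra! hlt
    -- otherwise `(q ^ r / N) ^ m` would be bounded by `N ^ c`
    have hN' : (0 : ℝ) < N := by exact_mod_cast hN
    obtain ⟨m, hm⟩ := pow_unbounded_of_one_lt ((N : ℝ) ^ c)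
      ((one_lt_div hN').mpr (by exact_mod_cast hlt : (N : ℝ) < (Nat.card F ^ r : ℕ)))
    rw [div_pow, lt_div_iff₀ (by positivity), ← pow_add, add_comm] at hm
    have h5 := hlow m
    rw [pow_mul] at h5
    have h6 : N ^ (m + c) < (Nat.card F ^ r) ^ m := by exact_mod_cast hm
    exact absurd h5 (not_le.mpr h6)
  rw [le_antisymm hle hge]
  push_cast
  rfl

end ProductFormula

end PlaceAtInfinity

namespace PlaceAtInfinity

/-! ### Strong approximation -/

section Existence

variable (F : Type*) {D : Type*} [Field F] [Finite F] [CommRing D] [IsDomain D] [Algebra F D]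

variable {F} in
theorem card_residueField_eq_pow (v : PlaceAtInfinity D) [Finite v.residueField] :
    ∃ f : ℕ, f ≠ 0 ∧ Nat.card v.residueField = Nat.card F ^ f := by
  let := ((IsLocalRing.residue v.ring).comp ((algebraMap F (FractionRing D)).codRestrict v.ring
    v.ring.algebraMap_mem_of_finite)).toAlgebra
  have : Module.Finite F v.residueField := .of_finite
  refine ⟨Module.finrank F v.residueField, Module.finrank_pos.ne', Module.natCard_eq_pow_finrank⟩

variable [Algebra F[X] D] [IsScalarTower F F[X] D] [Module.Finite F[X] D] [FaithfulSMul F[X] D]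
  [∀ v : PlaceAtInfinity D, Finite v.residueField]

variable (D)

include F in
/-- Strong approximation away from `D`: up to an error bounded at all places at infinity, every
element of `Frac D` is an element of `D`. In coordinates with respect to a basis of `D` over the
polynomial ring, the approximation is given by division with remainder. -/
theorem exists_forall_absVal_sub_algebraMap_le :
    ∃ C : ℝ, ∀ g : FractionRing D, ∃ a : D, ∀ v : PlaceAtInfinity D,
      v.absVal (g - algebraMap D (FractionRing D) a) ≤ C := by
  have := finite_of_finite F D
  have := Fintype.ofFinite (PlaceAtInfinity D)
  let b := Module.finBasis F[X] D
  refine ⟨∑ v : PlaceAtInfinity D, ∑ i, v.absVal (algebraMap D (FractionRing D) (b i)),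
    fun g ↦ ?_⟩
  obtain ⟨⟨d, y⟩, hy⟩ := IsLocalizedModule.surj (nonZeroDivisors F[X])
    (IsScalarTower.toAlgHom F[X] D (FractionRing D)).toLinearMap g
  have hy0 : (y : F[X]) ≠ 0 := nonZeroDivisors.ne_zero y.2
  have hyK : algebraMap F[X] (FractionRing D) y ≠ 0 := by simp
  have hg : algebraMap F[X] (FractionRing D) y * g =
      ∑ i, algebraMap F[X] (FractionRing D) (b.repr d i) * algebraMap D (FractionRing D) (b i) := by
    rw [← Algebra.smul_def]
    refine Eq.trans hy ?_
    change algebraMap D (FractionRing D) d = _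
    conv_lhs => rw [← b.sum_repr d]
    simp [Algebra.smul_def, ← IsScalarTower.algebraMap_apply]
  refine ⟨∑ i, (b.repr d i / (y : F[X])) • b i, fun v ↦ ?_⟩
  have hrem : g - algebraMap D (FractionRing D) (∑ i, (b.repr d i / (y : F[X])) • b i) =
      ∑ i, algebraMap F[X] (FractionRing D) (b.repr d i % (y : F[X])) /
        algebraMap F[X] (FractionRing D) y * algebraMap D (FractionRing D) (b i) := by
    refine mul_left_cancel₀ hyK ?_
    rw [mul_sub, hg, map_sum, Finset.mul_sum, Finset.mul_sum, ← Finset.sum_sub_distrib]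
    refine Finset.sum_congr rfl fun i _ ↦ ?_
    rw [Algebra.smul_def, map_mul, ← IsScalarTower.algebraMap_apply]
    have h := congrArg (algebraMap F[X] (FractionRing D))
      (EuclideanDomain.div_add_mod (b.repr d i) (y : F[X]))
    rw [map_add, map_mul] at h
    field_simp
    linear_combination (- algebraMap D (FractionRing D) (b i)) * h
  rw [hrem]
  refine (v.absVal.sum_le _ _).trans (le_trans ?_ (Finset.single_le_sum
    (f := fun v : PlaceAtInfinity D ↦ ∑ i, v.absVal (algebraMap D (FractionRing D) (b i)))
    (fun w _ ↦ Finset.sum_nonneg fun i _ ↦ w.absVal.nonneg _) (Finset.mem_univ v)))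
  refine Finset.sum_le_sum fun i _ ↦ ?_
  rw [map_mul]
  refine mul_le_of_le_one_left (v.absVal.nonneg _) ?_
  by_cases h0 : b.repr d i % (y : F[X]) = 0
  · simp [h0]
  have h1 := one_lt_absVal_X F v
  rw [map_div₀, v.absVal_algebraMap_polynomial h0, v.absVal_algebraMap_polynomial hy0,
    div_le_one (by positivity)]
  exact pow_le_pow_right₀ h1.le (natDegree_le_natDegree (EuclideanDomain.mod_lt _ hy0).le)

include F in
/-- There is an element of `D` with the same absolute value, larger than `1`, at all places. -/
theorem exists_forall_absVal_eq :
    ∃ (a : D) (M : ℝ), 1 < M ∧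
      ∀ v : PlaceAtInfinity D, v.absVal (algebraMap D (FractionRing D) a) = M := by
  have := finite_of_finite F D
  have := Fintype.ofFinite (PlaceAtInfinity D)
  obtain ⟨C, hC⟩ := exists_forall_absVal_sub_algebraMap_le F D
  choose f hf0 hf using fun v : PlaceAtInfinity D ↦ v.card_residueField_eq_pow (F := F)
  have hq : (1 : ℝ) < Nat.card F := by exact_mod_cast Finite.one_lt_card
  obtain ⟨k, hk⟩ := pow_unbounded_of_one_lt (max C 1) hq
  -- `M` is a power of every residue cardinality, and exceeds the error of the approximation
  set M : ℝ := (Nat.card F : ℝ) ^ (k * ∏ v, f v) with hM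
  have hCM : max C 1 < M := hk.trans_le (pow_le_pow_right₀ hq.le
    (Nat.le_mul_of_pos_right _ (Finset.prod_pos fun v _ ↦ Nat.pos_of_ne_zero (hf0 v))))
  have hx (v : PlaceAtInfinity D) : ∃ x, v.absVal x = M := by
    obtain ⟨e, he⟩ := Finset.dvd_prod_of_mem f (Finset.mem_univ v)
    obtain ⟨x, hx⟩ := v.exists_absVal_eq_pow (e * k)
    refine ⟨x, ?_⟩
    rw [hx, hf, hM, he]
    push_cast
    rw [← pow_mul]
    congr 1
    ring
  choose x hx using hx
  obtain ⟨g, hg⟩ := exists_forall_absVal_sub_lt (u := id) Function.injective_id x one_pos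
  obtain ⟨a, ha⟩ := hC g
  refine ⟨a, M, (le_max_right _ _).trans_lt hCM, fun v ↦ ?_⟩
  have h1 : v.absVal (algebraMap D (FractionRing D) a - x v) < v.absVal (x v) := by
    have e : algebraMap D (FractionRing D) a - x v =
      -(g - algebraMap D (FractionRing D) a) + (g - x v) := by ring
    rw [e, hx]
    refine (v.isNonarchimedean_absVal _ _).trans_lt (lt_of_le_of_lt ?_ hCM)
    rw [map_neg_eq_map]
    exact max_le_max (ha v) (hg v).le
  rw [← hx v, ← sub_add_cancel (algebraMap D (FractionRing D) a) (x v)]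
  exact v.isNonarchimedean_absVal.add_eq_right_of_lt h1

end Existence

end PlaceAtInfinity

/-! ### Noether normalization -/

section NoetherNormalization

/-- Noether normalization in dimension one: a finitely generated algebra of dimension one without
zero divisors is finite over a polynomial ring in one variable. -/
theorem exists_finite_injective_polynomial_algHom (k D : Type*) [Field k] [CommRing D] [IsDomain D]
    [Ring.DimensionLEOne D] [Algebra k D] [Algebra.FiniteType k D] (hD : ¬ IsField D) :
    ∃ φ : k[X] →ₐ[k] D, Function.Injective φ ∧ φ.Finite := by
  obtain ⟨s, g, hinj, hfin⟩ := exists_finite_inj_algHom_of_fg k D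
  let := g.toRingHom.toAlgebra
  have : Module.Finite (MvPolynomial (Fin s) k) D := hfin
  have hinj' : Function.Injective (algebraMap (MvPolynomial (Fin s) k) D) := hinj
  have : FaithfulSMul (MvPolynomial (Fin s) k) D :=
    (faithfulSMul_iff_algebraMap_injective _ _).mpr hinj'
  have hdim {P : Ideal (MvPolynomial (Fin s) k)} (hP : P.IsPrime) (h0 : P ≠ ⊥) : P.IsMaximal := by
    obtain ⟨Q, hQ, rfl⟩ := Ideal.exists_ideal_over_prime_of_isIntegral_of_isDomain (S := D) P
      (by rw [(RingHom.injective_iff_ker_eq_bot _).mp hinj']; exact bot_le)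
    have : Q ≠ ⊥ := by
      rintro rfl
      exact h0 (Ideal.comap_bot_of_injective _ hinj')
    have := Ring.DimensionLEOne.maximalOfPrime this hQ
    exact Ideal.isMaximal_comap_of_isIntegral_of_isMaximal Q
  rcases s with _ | _ | s
  · refine absurd (isField_of_isIntegral_of_isField' (R := MvPolynomial (Fin 0) k) ?_) hD
    exact (MvPolynomial.isEmptyAlgEquiv k (Fin 0)).toMulEquiv.isField (Field.toIsField k)
  · let : Unique (Fin (0 + 1)) := inferInstanceAs (Unique (Fin 1))
    let e := MvPolynomial.uniqueAlgEquiv k (Fin (0 + 1))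
    refine ⟨g.comp e.symm.toAlgHom, hinj.comp e.symm.injective, ?_⟩
    exact RingHom.Finite.comp hfin (RingHom.Finite.of_surjective _ e.symm.surjective)
  · -- the kernel of `X₀ ↦ 0`, `X_i ↦ X` is a nonzero prime ideal which is not maximal
    exfalso
    let ψ : MvPolynomial (Fin (s + 1 + 1)) k →ₐ[k] k[X] :=
      MvPolynomial.aeval fun i ↦ if i = 0 then 0 else X
    have hψ : Function.Surjective ψ := by
      refine fun p ↦ ⟨aeval (MvPolynomial.X 1) p, ?_⟩
      rw [← aeval_algHom_apply]
      simp [ψ]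
    have hmax := hdim (RingHom.ker_isPrime (ψ : MvPolynomial (Fin (s + 1 + 1)) k →+* k[X])) fun h ↦
      MvPolynomial.X_ne_zero (R := k) (0 : Fin (s + 1 + 1))
        ((Submodule.mem_bot _).mp (h.le (show ψ (MvPolynomial.X 0) = 0 by simp [ψ])))
    have hfield := (Ideal.Quotient.maximal_ideal_iff_isField_quotient _).mp hmax
    exact not_isField k ((RingHom.quotientKerEquivOfSurjective
      (f := (ψ : MvPolynomial (Fin (s + 1 + 1)) k →+* k[X])) hψ).symm.toMulEquiv.isField hfield)

end NoetherNormalization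

namespace PlaceAtInfinity

/-! ### Local degrees -/

section Rank

variable {F D : Type*} [Field F] [Finite F] [CommRing D] [IsDomain D] [Algebra F D]
  [Algebra F[X] D] [IsScalarTower F F[X] D] [Module.Finite F[X] D]

theorem exists_absVal_X_eq_pow (v : PlaceAtInfinity D) [Finite v.residueField] :
    ∃ d : ℕ, d ≠ 0 ∧
      v.absVal (algebraMap F[X] (FractionRing D) X) = (Nat.card F : ℝ) ^ d := by
  obtain ⟨f, hf0, hf⟩ := v.card_residueField_eq_pow (F := F)
  have h1 := one_lt_absVal_X F v
  have hX : algebraMap F[X] (FractionRing D) X ≠ 0 := by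
    intro h
    rw [h, map_zero] at h1
    linarith
  have hc : (1 : ℝ) < Nat.card v.residueField := by exact_mod_cast v.one_lt_card_residueField
  rw [v.absVal_eq_zpow_ord hX] at h1 ⊢
  have h2 := (one_lt_zpow_iff_right₀ hc).mp h1
  obtain ⟨e, he⟩ := Int.eq_ofNat_of_zero_le h2.le
  rw [he] at h2 ⊢
  refine ⟨f * e, mul_ne_zero hf0 (by omega), ?_⟩
  rw [hf, zpow_natCast, pow_mul, Nat.cast_pow]

variable [FaithfulSMul F[X] D] [∀ v : PlaceAtInfinity D, Finite v.residueField]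

theorem sum_eq_finrank [Fintype (PlaceAtInfinity D)] {d : PlaceAtInfinity D → ℕ}
    (hd : ∀ v : PlaceAtInfinity D,
      v.absVal (algebraMap F[X] (FractionRing D) X) = (Nat.card F : ℝ) ^ d v) :
    ∑ v, d v = Module.finrank F[X] D := by
  have h := prod_absVal_X F (D := D)
  simp_rw [hd] at h
  rw [Finset.prod_pow_eq_pow_sum] at h
  exact Nat.pow_right_injective (Finite.one_lt_card (α := F)) (by exact_mod_cast h)

/-- Over the polynomial ring itself, where the rank is one, there is only one place. -/
theorem exists_unique_of_finrank_eq_one (h : Module.finrank F[X] D = 1) :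
    ∃ v : PlaceAtInfinity D, (∀ w, w = v) ∧
      v.absVal (algebraMap F[X] (FractionRing D) X) = Nat.card F := by
  have := finite_of_finite F D
  have := Fintype.ofFinite (PlaceAtInfinity D)
  choose d hd0 hd using fun v : PlaceAtInfinity D ↦ v.exists_absVal_X_eq_pow (F := F)
  have hsum := (sum_eq_finrank hd).trans h
  obtain ⟨v⟩ := nonempty_of_finite F D
  have hle (w : PlaceAtInfinity D) (hw : w ≠ v) : False := by
    classical
    have h1 := Finset.sum_le_univ_sum_of_nonneg (s := {w, v}) (fun w ↦ Nat.zero_le (d w))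
    rw [Finset.sum_pair hw] at h1
    have := hd0 v
    have := hd0 w
    omega
  refine ⟨v, fun w ↦ by_contra (hle w), ?_⟩
  have h1 := Finset.sum_le_univ_sum_of_nonneg (s := {v}) (fun w ↦ Nat.zero_le (d w))
  rw [Finset.sum_singleton] at h1
  have h2 : d v = 1 := by have := hd0 v; omega
  rw [hd, h2, pow_one]

end Rank

end PlaceAtInfinity

/-! ### Admissible elements -/

section AdmissibleElements

open PlaceAtInfinity

theorem finrank_eq_of_bijective_algebraMap {A B D : Type*} [CommRing A] [CommRing B] [CommRing D]
    [Algebra A B] [Algebra B D] [Algebra A D] [IsScalarTower A B D]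
    (h : Function.Bijective (algebraMap A B)) : Module.finrank A D = Module.finrank B D :=
  Algebra.finrank_eq_of_equiv_equiv (RingEquiv.ofBijective _ h) (RingEquiv.refl D)
    (RingHom.ext fun a ↦ (IsScalarTower.algebraMap_apply A B D a).symm)

/-- The conclusion about an admissible element, when it is the image of the variable and the subring
it generates is given as an isomorphic copy `O` of `F[X]`. -/
theorem exists_norm_X_eq_pow {F D : Type*} (O : Type*) [Field F] [Finite F] [CommRing D]
    [IsDomain D] [Algebra F D] [Algebra F[X] D] [IsScalarTower F F[X] D] [Module.Finite F[X] D]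
    [FaithfulSMul F[X] D] [CommRing O] [IsDomain O] [Algebra F O] [Algebra F[X] O]
    [IsScalarTower F F[X] O] [Algebra O D] [IsScalarTower F[X] O D]
    (hO : Function.Bijective (algebraMap F[X] O))
    (ht : ∀ v w : PlaceAtInfinity D, v.norm (algebraMap F[X] D X) = w.norm (algebraMap F[X] D X)) :
    ∃ d : ℕ,
      (∀ v : PlaceAtInfinity D, v.norm (algebraMap F[X] D X) = (Nat.card F : ℝ) ^ d) ∧
      Module.finrank O D = Nat.card (PlaceAtInfinity D) * d ∧
      (∀ (f : O) (v : PlaceAtInfinity D), canonicalNorm f ^ d = v.norm (algebraMap O D f)) ∧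
      ∀ f : O, canonicalNorm f ^ d = canonicalNorm (algebraMap O D f) := by
  have : Module.Finite F[X] O := .of_surjective (Algebra.linearMap F[X] O) hO.surjective
  have : FaithfulSMul F[X] O := (faithfulSMul_iff_algebraMap_injective _ _).mpr hO.injective
  have (v : PlaceAtInfinity D) := v.finite_residueField F
  have (v : PlaceAtInfinity O) := v.finite_residueField F
  have := finite_of_finite F D
  have := Fintype.ofFinite (PlaceAtInfinity D)
  obtain ⟨v₀⟩ := nonempty_of_finite F D
  have hrankO : Module.finrank F[X] O = 1 :=
    (LinearEquiv.ofBijective (Algebra.linearMap F[X] O) hO).finrank_eq.symm.trans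
      (Module.finrank_self _)
  obtain ⟨w, hw, hwX⟩ := exists_unique_of_finrank_eq_one hrankO
  have hcan (f : O) : canonicalNorm f = w.norm f := by
    have : Nonempty (PlaceAtInfinity O) := ⟨w⟩
    exact (iSup_congr fun v ↦ by rw [hw v]).trans ciSup_const
  obtain ⟨d, hd0, hd⟩ := v₀.exists_absVal_X_eq_pow (F := F)
  have hnorm (v : PlaceAtInfinity D) :
      v.absVal (algebraMap F[X] (FractionRing D) X) = v.norm (algebraMap F[X] D X) := by
    rw [v.norm_eq_absVal, ← IsScalarTower.algebraMap_apply]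
  have hdv (v : PlaceAtInfinity D) : v.norm (algebraMap F[X] D X) = (Nat.card F : ℝ) ^ d := by
    rw [ht v v₀, ← hnorm, hd]
  have hres (f : O) (v : PlaceAtInfinity D) :
      canonicalNorm f ^ d = v.norm (algebraMap O D f) := by
    obtain ⟨p, rfl⟩ := hO.surjective f
    rw [hcan, w.norm_eq_absVal, v.norm_eq_absVal, ← IsScalarTower.algebraMap_apply F[X] O D,
      ← IsScalarTower.algebraMap_apply, ← IsScalarTower.algebraMap_apply]
    by_cases hp : p = 0
    · simp [hp, hd0]
    rw [v.absVal_algebraMap_polynomial hp, w.absVal_algebraMap_polynomial hp, hwX, hnorm, hdv,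
      ← pow_mul, ← pow_mul, mul_comm]
  refine ⟨d, hdv, ?_, hres, fun f ↦ ?_⟩
  · have hsum := sum_eq_finrank (F := F) (D := D) (d := fun _ ↦ d)
      fun v ↦ (hnorm v).trans (hdv v)
    rw [Finset.sum_const, Finset.card_univ, smul_eq_mul, Fintype.card_eq_nat_card] at hsum
    exact (finrank_eq_of_bijective_algebraMap hO).symm.trans hsum.symm
  · have : Nonempty (PlaceAtInfinity D) := ⟨v₀⟩
    rw [canonicalNorm.eq_1 (algebraMap O D f)]
    simp_rw [← hres f]
    exact ciSup_const.symm

/-- The conclusion about admissible elements, for an arbitrary finite field `F` of constants. The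
subring `O` is `F[t]`. -/
theorem exists_norm_eq_pow_of_finite {F D : Type*} [Field F] [Finite F] [CommRing D] [IsDomain D]
    [Algebra F D] (hD : ¬ IsField D) {t : D} {O : Subring D}
    (hO : O = (Algebra.adjoin F {t}).toSubring) [Module.Finite O D]
    (ht : ∀ v w : PlaceAtInfinity D, v.norm t = w.norm t) :
    ∃ d : ℕ,
      (∀ v : PlaceAtInfinity D, v.norm t = (Nat.card F : ℝ) ^ d) ∧
      Module.finrank O D = Nat.card (PlaceAtInfinity D) * d ∧
      (∀ (f : O) (v : PlaceAtInfinity D), canonicalNorm f ^ d = v.norm (f : D)) ∧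
      ∀ f : O, canonicalNorm f ^ d = canonicalNorm (f : D) := by
  let : Algebra F[X] D := (aeval (R := F) t).toRingHom.toAlgebra
  have hmem (x : D) : x ∈ O ↔ ∃ p : F[X], algebraMap F[X] D p = x := by
    rw [hO, Subalgebra.mem_toSubring, Algebra.adjoin_singleton_eq_range_aeval]
    rfl
  have hX : algebraMap F[X] D X = t := aeval_X t
  have : IsScalarTower F F[X] D := .of_algebraMap_eq fun c ↦ (aeval_C t c).symm
  let : Algebra F[X] O :=
    ((algebraMap F[X] D).codRestrict O fun p ↦ (hmem _).mpr ⟨p, rfl⟩).toAlgebra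
  let : Algebra F O := ((algebraMap F[X] O).comp C).toAlgebra
  have : IsScalarTower F F[X] O := .of_algebraMap_eq fun c ↦ rfl
  have : IsScalarTower F[X] O D := .of_algebraMap_eq fun c ↦ rfl
  have hsurj : Function.Surjective (algebraMap F[X] O) := fun ⟨x, hx⟩ ↦ by
    obtain ⟨p, rfl⟩ := (hmem x).mp hx
    exact ⟨p, rfl⟩
  have : Module.Finite F[X] O := .of_surjective (Algebra.linearMap F[X] O) hsurj
  have : Module.Finite F[X] D := .trans O D
  -- if `t` is algebraic over `F`, then `D` is integral over `F`, hence a field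
  have hinj : Function.Injective (algebraMap F[X] D) := by
    refine (injective_iff_map_eq_zero _).mpr fun p hp ↦ by_contra fun hp0 ↦ hD ?_
    have h1 : IsIntegral F t := IsAlgebraic.isIntegral ⟨p, hp0, hp⟩
    have : IsScalarTower F O D :=
      .of_algebraMap_eq fun c ↦ IsScalarTower.algebraMap_apply F F[X] D c
    have : Algebra.IsIntegral F O := ⟨fun x ↦
      (isIntegral_algebraMap_iff (A := O) (B := D) Subtype.val_injective).mp
        (adjoin_le_integralClosure h1 (hO ▸ x.2 : (x : D) ∈ (Algebra.adjoin F {t}).toSubring))⟩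
    have : Algebra.IsIntegral F D := .trans O
    exact isField_of_isIntegral_of_isField' (Field.toIsField F)
  have : FaithfulSMul F[X] D := (faithfulSMul_iff_algebraMap_injective _ _).mpr hinj
  have hbij : Function.Bijective (algebraMap F[X] O) :=
    ⟨fun p q h ↦ hinj (congrArg Subtype.val h), hsurj⟩
  have h := exists_norm_X_eq_pow O hbij (D := D) (by rwa [hX])
  rw [hX] at h
  exact h

theorem exists_isAdmissible (p : ℕ) [Fact p.Prime] {D : Type*} [CommRing D] [IsDomain D]
    [Algebra (ZMod p) D] [Algebra.FiniteType (ZMod p) D] [Algebra (ZMod p)[X] D]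
    [IsScalarTower (ZMod p) (ZMod p)[X] D] [Module.Finite (ZMod p)[X] D]
    [FaithfulSMul (ZMod p)[X] D] : ∃ t : D, IsAdmissible p t := by
  have (v : PlaceAtInfinity D) := v.finite_residueField (ZMod p)
  obtain ⟨t, M, hM, ht⟩ := PlaceAtInfinity.exists_forall_absVal_eq (ZMod p) D
  -- the norms of `t` agree by construction; finiteness follows from integrality
  refine ⟨t, ?_, fun v w ↦ by rw [v.norm_eq_absVal, w.norm_eq_absVal, ht, ht]⟩
  have htO : t ∈ polySubring p t :=
    Subalgebra.mem_toSubring.mpr (Algebra.self_mem_adjoin_singleton _ t)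
  have hint : Algebra.IsIntegral (polySubring p t) D := by
    refine ⟨fun x ↦ (isIntegral_algebraMap_iff (IsFractionRing.injective D (FractionRing D))).mp
      (isIntegral_of_forall_valuationSubring fun V hV ↦ ?_)⟩
    by_cases hXV : algebraMap (ZMod p)[X] (FractionRing D) X ∈ V
    · exact PlaceAtInfinity.range_le_of_X_mem hXV ⟨x, rfl⟩
    -- `V` is then a place at infinity, where `t` has a pole
    · have h1 : algebraMap D (FractionRing D) t ∈ V := hV ⟨⟨t, htO⟩, rfl⟩
      have h2 := (PlaceAtInfinity.ofXNotMem V hXV).absVal_le_one_iff.mpr h1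
      rw [ht] at h2
      linarith
  let : Algebra (ZMod p) (polySubring p t) :=
    inferInstanceAs (Algebra (ZMod p) (Algebra.adjoin (constantField p D) {t}))
  have : IsScalarTower (ZMod p) (polySubring p t) D :=
    inferInstanceAs (IsScalarTower (ZMod p) (Algebra.adjoin (constantField p D) {t}) D)
  have : Algebra.FiniteType (polySubring p t) D := .of_restrictScalars_finiteType (ZMod p) _ _
  exact Algebra.IsIntegral.finite

/-- The field of constants embeds into the residue field of any place. -/
theorem finite_integralClosure_of_place (F : Type*) {D : Type*} [Field F] [Finite F] [CommRing D]
    [IsDomain D] [Algebra F D] (v : PlaceAtInfinity D) [Finite v.residueField] :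
    Finite (integralClosure F D) := by
  have hint (x : integralClosure F D) : IsIntegral F (algebraMap D (FractionRing D) x) :=
    IsIntegral.algebraMap x.2
  let f (x : integralClosure F D) : v.residueField :=
    IsLocalRing.residue v.ring ⟨_, v.ring.mem_of_isIntegral_of_finite (hint x)⟩
  refine .of_injective f fun x y hxy ↦ ?_
  by_contra hne
  have h1 := v.absVal_coe_lt_one_iff.mpr (Ideal.Quotient.eq.mp hxy)
  have h2 := v.absVal_eq_one_of_isIntegral (hint (x - y))
    ((map_ne_zero_iff _ (IsFractionRing.injective D _)).mpr
      fun h ↦ hne (sub_eq_zero.mp (Subtype.ext h)))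
  rw [AddSubgroupClass.coe_sub, map_sub] at h2
  exact h1.ne h2

end AdmissibleElements

theorem proposition2 (p : ℕ) [Fact p.Prime] (D : Type*) [CommRing D] [IsDedekindDomain D]
    [Algebra (ZMod p) D] [Algebra.FiniteType (ZMod p) D] (hD : ¬ IsField D) :
    (∃ t : D, IsAdmissible p t) ∧
    Finite (PlaceAtInfinity D) ∧ Nonempty (PlaceAtInfinity D) ∧
    ∀ t : D, IsAdmissible p t →
      ∃ d : ℕ,
        (∀ v : PlaceAtInfinity D, v.norm t = (Nat.card (constantField p D) : ℝ) ^ d) ∧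
        Module.finrank (polySubring p t) D = Nat.card (PlaceAtInfinity D) * d ∧
        (∀ (f : polySubring p t) (v : PlaceAtInfinity D),
          canonicalNorm f ^ d = v.norm (f : D)) ∧
        ∀ f : polySubring p t, canonicalNorm f ^ d = canonicalNorm (f : D) := by
  obtain ⟨φ, hinj, hfin⟩ := exists_finite_injective_polynomial_algHom (ZMod p) D hD
  let : Algebra (ZMod p)[X] D := φ.toRingHom.toAlgebra
  have : IsScalarTower (ZMod p) (ZMod p)[X] D := .of_algebraMap_eq fun c ↦ (φ.commutes c).symm
  have : Module.Finite (ZMod p)[X] D := hfin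
  have : FaithfulSMul (ZMod p)[X] D := (faithfulSMul_iff_algebraMap_injective _ _).mpr hinj
  have hne := PlaceAtInfinity.nonempty_of_finite (ZMod p) D
  refine ⟨exists_isAdmissible p, PlaceAtInfinity.finite_of_finite (ZMod p) D, hne,
    fun t ⟨hft, ht⟩ ↦ ?_⟩
  obtain ⟨v⟩ := hne
  have := v.finite_residueField (ZMod p)
  have := finite_integralClosure_of_place (ZMod p) v
  let : Field (constantField p D) := (Finite.isField_of_domain (constantField p D)).toField
  exact exists_norm_eq_pow_of_finite (F := constantField p D) hD rfl ht
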